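/- **Setting.** Let $X$ be a real Banach space and $I=\Phi+\Psi$ with $\Phi\in C^1(X,\mathbb R)$ and $\Psi:X\to(-\infty,\infty]$ convex, lower semicontinuous and $\Psi\not\equiv\infty$ (this is written $I\in(H_0)$). A point $u\in X$ is a *critical point* of $I$ if $I(u)<\infty$ and $\langle\Phi'(u),v-u\rangle+\Psi(v)-\Psi(u)\ge 0$ for all $v\in X$; a value $c\in\mathbb R$ is a *critical value* if $c=I(u)$ for some critical point $u$. The functional $I$ satisfies $(\mathrm{PS})$ if for every $c\in\mathbb R$, every sequence $(u_n)$ in $\{I<\infty\}$ with $I(u_n)\to c$ and $$\langle\Phi'(u_n),v-u_n\rangle+\Psi(v)-\Psi(u_n)\ge-\varepsilon_n\|v-u_n\|\qquad\text{for all } v\in X,\ n\in\mathbb N,$$ for some $\varepsilon_n\to0^+$, has a convergent subsequence. Let $G$ be a compact topological group. Assume $(G_0)$: $G$ acts continuously, linearly and isometrically on $X$, and $X=\overline{\bigoplus_{j\in\mathbb N}X_j}$, where each $X_j$ is a $G$-invariant subspace isomorphic, as a representation of $G$, to a fixed finite-dimensional real representation $Y$ of $G$ whose action is *admissible*: for every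 $k\ge2$ and every bounded $G$-invariant open set $U\subset Y^k$ with $0\in U$, where $G$ acts diagonally on $Y^k$, every continuous equivariant map $\partial U\to Y^{k-1}$ has a zero. Let $\Sigma$ be the class of $G$-invariant closed subsets of $X$ that do not contain $0$. For nonempty $A\in\Sigma$ let $\gamma_G(A)$ be the least integer $k\ge1$ for which there is a continuous equivariant map $A\to Y^k\setminus\{0\}$, and $\gamma_G(A)=\infty$ if there is none; put $\gamma_G(\emptyset)=0$. For $j\in\mathbb N$ let $\Gamma_j$ be the closure, with respect to the Hausdorff metric on nonempty compact subsets of $X$, of the family of nonempty compact $G$-invariant sets $A$ with $0\notin A$ and $\gamma_G(A)\ge j$, and let $$c_j:=\inf_{A\in\Gamma_j}\ \sup_{u\in A}I(u).$$ **Theorem.** Suppose that $I=\Phi+\Psi\in(H_0)$ satisfies $(\mathrm{PS})$, that $\Phi$ and $\Psi$ are $G$-invariant, that $I(0)=0$, that $(G_0)$ holds, and that $\gamma_G(A)<\infty$ for every compact $A\in\Sigma$. Assume moreover that 1. $c_j>-\infty$ for every $j\in\mathbb N$; 2. for every $j\in\mathbb N$ there is a nonempty compact set $A\in\Sigma$ with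 $\gamma_G(A)\ge j$ and $\sup_{u\in A}I(u)<0$. Then every $c_j$ is a negative critical value of $I$, and $\lim_{j\to\infty}c_j=0$. -/

import Mathlib

open Filter Topology TopologicalSpace

namespace SzulkinHeinz

section Functional

variable {X : Type*} [NormedAddCommGroup X] [NormedSpace ℝ X]

/-- The class of functionals `I = Φ + Ψ : X → (-∞, ∞]` with `Φ` of class `C¹` and
`Ψ : X → (-∞, ∞]` convex, lower semicontinuous and not identically `∞`. -/
structure ClassH0 (Φ : X → ℝ) (Ψ : X → EReal) : Prop where
  contDiff : ContDiff ℝ 1 Φ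
  ne_bot : ∀ u, Ψ u ≠ ⊥
  convex : ∀ u v : X, ∀ a b : ℝ, 0 < a → 0 < b → a + b = 1 →
    Ψ (a • u + b • v) ≤ (a : EReal) * Ψ u + (b : EReal) * Ψ v
  lsc : LowerSemicontinuous Ψ
  proper : ∃ u, Ψ u ≠ ⊤

/-- The functional `I = Φ + Ψ`. -/
noncomputable def energy (Φ : X → ℝ) (Ψ : X → EReal) (u : X) : EReal :=
  (Φ u : EReal) + Ψ u

/-- `u` is a critical point of `I = Φ + Ψ`: `u` lies in the effective domain and
`⟨Φ'(u), v - u⟩ + Ψ(v) - Ψ(u) ≥ 0` for all `v`. -/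
def IsCriticalPoint (Φ : X → ℝ) (Ψ : X → EReal) (u : X) : Prop :=
  energy Φ Ψ u < ⊤ ∧
    ∀ v : X, 0 ≤ ((fderiv ℝ Φ u (v - u) : ℝ) : EReal) + (Ψ v - Ψ u)

/-- `(uₙ)` is a Palais–Smale sequence at level `c`: `I(uₙ) → c` and, for some `εₙ → 0⁺`,
`⟨Φ'(uₙ), v - uₙ⟩ + Ψ(v) - Ψ(uₙ) ≥ -εₙ ‖v - uₙ‖` for all `v`. -/
def IsPSSequence (Φ : X → ℝ) (Ψ : X → EReal) (c : ℝ) (u : ℕ → X) : Prop :=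
  (∀ n, energy Φ Ψ (u n) < ⊤) ∧
  Tendsto (fun n => energy Φ Ψ (u n)) atTop (𝓝 (c : EReal)) ∧
  ∃ ε : ℕ → ℝ, (∀ n, 0 < ε n) ∧ Tendsto ε atTop (𝓝 0) ∧
    ∀ n, ∀ v : X, ((-(ε n * ‖v - u n‖) : ℝ) : EReal) ≤
      ((fderiv ℝ Φ (u n) (v - u n) : ℝ) : EReal) + (Ψ v - Ψ (u n))

/-- The Palais–Smale condition at every real level. -/
def PalaisSmale (Φ : X → ℝ) (Ψ : X → EReal) : Prop :=
  ∀ (c : ℝ) (u : ℕ → X), IsPSSequence Φ Ψ c u →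
    ∃ (x : X) (σ : ℕ → ℕ), StrictMono σ ∧ Tendsto (u ∘ σ) atTop (𝓝 x)

end Functional

section Action

/-- `gA = A` for every `g`. -/
def InvariantSet (G : Type*) {Z : Type*} [SMul G Z] (A : Set Z) : Prop :=
  ∀ g : G, (fun x => g • x) '' A = A

/-- `φ` restricted to `A` is continuous and equivariant. -/
def EquivariantMapOn (G : Type*) {Z W : Type*} [SMul G Z] [SMul G W] [TopologicalSpace Z]
    [TopologicalSpace W] (φ : Z → W) (A : Set Z) : Prop :=
  ContinuousOn φ A ∧ ∀ g : G, ∀ x ∈ A, φ (g • x) = g • φ x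

/-- The action of `G` on the finite dimensional space `Y` is admissible: for all `k ≥ 1`, every
continuous equivariant map `∂U → Yᵏ`, where `U ⊆ Yᵏ⁺¹` is a bounded open invariant neighbourhood
of `0`, has a zero. Powers of `Y` carry the diagonal action. -/
def AdmissibleAction (G Y : Type*) [Group G] [NormedAddCommGroup Y] [DistribMulAction G Y] :
    Prop :=
  ∀ k : ℕ, 1 ≤ k → ∀ U : Set (Fin (k + 1) → Y), IsOpen U → Bornology.IsBounded U →
    InvariantSet G U → 0 ∈ U →
    ∀ φ : (Fin (k + 1) → Y) → (Fin k → Y), EquivariantMapOn G φ (frontier U) →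
      ∃ u ∈ frontier U, φ u = 0

variable (G X Y : Type*) [Group G] [NormedAddCommGroup X] [NormedSpace ℝ X]
  [DistribMulAction G X] [NormedAddCommGroup Y] [NormedSpace ℝ Y] [DistribMulAction G Y]

/-- `G` acts isometrically on `X`, the action on `Y` is admissible, and `X` is the closure of the
direct sum of invariant subspaces `V j`, `j ∈ ℕ`, each isomorphic to `Y` as a representation. -/
def ConditionG0 : Prop :=
  (∀ (g : G) (x : X), ‖g • x‖ = ‖x‖) ∧
  AdmissibleAction G Y ∧
  ∃ V : ℕ → Submodule ℝ X,
    iSupIndep V ∧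
    (⨆ j, V j).topologicalClosure = ⊤ ∧
    (∀ j, ∀ g : G, ∀ x ∈ V j, g • x ∈ V j) ∧
    ∀ j, ∃ e : Y ≃ₗ[ℝ] V j, ∀ (g : G) (y : Y), (e (g • y) : X) = g • (e y : X)

variable {X}

/-- The class `Σ` of invariant closed subsets of `X` that do not contain `0`. -/
def SigmaClass (A : Set X) : Prop :=
  InvariantSet G A ∧ IsClosed A ∧ (0 : X) ∉ A

open Classical in
/-- The `G`-index of `A`: the least `k ≥ 1` for which there is a continuous equivariant map
`A → Yᵏ \ {0}`, `∞` if there is none, and `0` if `A` is empty. -/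
noncomputable def gIndex (A : Set X) : ℕ∞ :=
  if A = ∅ then 0 else
    sInf {n : ℕ∞ | ∃ k : ℕ, 1 ≤ k ∧ n = k ∧
      ∃ φ : X → (Fin k → Y), EquivariantMapOn G φ A ∧ ∀ x ∈ A, φ x ≠ 0}

/-- `Γ_j`: the closure, in the Hausdorff metric, of the family of nonempty compact invariant sets
that do not contain `0` and have index at least `j`. -/
def GammaFamily (j : ℕ) : Set (NonemptyCompacts X) :=
  closure {A : NonemptyCompacts X | InvariantSet G (A : Set X) ∧ (0 : X) ∉ (A : Set X) ∧
    (j : ℕ∞) ≤ gIndex G Y (A : Set X)}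

/-- `c_j = inf_{A ∈ Γ_j} sup_{u ∈ A} I(u)`, as an extended real number. -/
noncomputable def minimaxValue (Φ : X → ℝ) (Ψ : X → EReal) (j : ℕ) : EReal :=
  ⨅ A ∈ GammaFamily (X := X) G Y j, ⨆ u ∈ (A : Set X), energy Φ Ψ u

end Action

end SzulkinHeinz

open SzulkinHeinz

/-! Since `Ψ` is only lower semicontinuous, no gradient flow is available. Instead, Ekeland's
principle is applied on `Γ_j` itself, a closed subset of the complete space of nonempty compact
sets, to the lower semicontinuous function `A ↦ sup_A I`.

The core is a gap estimate, `exists_minimaxValue_gap`: if `c < 0` and the critical set `K` at level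
`c` has index at most `n`, then for some `δ > 0` and all `j ≥ 1`, `c_j > c - δ` forces `c_{j+n} ≥ c
+ δ`. Otherwise take a set in `Γ_{j+n}` with supremum below `c + δ`. Removing a neighbourhood of `K`
costs at most `n` in index, so a set of `Γ_j` is left, and Ekeland turns it into an almost minimal
set `A` still away from `K`. By (PS) the slope on `A` is bounded below near level `c`, so one short
equivariant step `u ↦ u + s W(u)` (`ClassH0.eventually_exists_deformation`) lowers the supremum
faster than Ekeland permits.

With `n = 0` the estimate shows that `c_j` is critical. If `c = sup c_j` were negative, `K` would be
compact without `0`, hence of finite index `n`, and `c_{j+n} ≥ c + δ` would be absurd. -/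

namespace SzulkinHeinz

/-! ### Haar averaging -/

section Average

variable {G : Type*} [Group G] [TopologicalSpace G] [IsTopologicalGroup G] [CompactSpace G]

open MeasureTheory in
/-- Averaging over the Haar measure of a compact group turns a continuous map into a continuous
equivariant map, whose values stay in the closed convex sets containing the whole orbit. -/
theorem exists_equivariant_average {Z E : Type*} [TopologicalSpace Z] [MulAction G Z]
    [ContinuousSMul G Z] [NormedAddCommGroup E] [NormedSpace ℝ E] [CompleteSpace E]
    [DistribMulAction G E] [SMulCommClass G ℝ E] [ContinuousSMul G E] {f : Z → E}
    (hf : Continuous f) :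
    ∃ F : Z → E, Continuous F ∧ (∀ (g : G) (z : Z), F (g • z) = g • F z) ∧
      ∀ (z : Z) (C : Set E), Convex ℝ C → IsClosed C →
        (∀ g : G, g • f (g⁻¹ • z) ∈ C) → F z ∈ C := by
  borelize G
  let μ : Measure G := Measure.haarMeasure ⊤
  have hμ : IsProbabilityMeasure μ := ⟨by
    simpa using (Measure.haarMeasure_self (K₀ := (⊤ : PositiveCompacts G)))⟩
  have hcont : ∀ z, Continuous fun g : G => g • f (g⁻¹ • z) := fun z => by fun_prop
  have hint : ∀ z, Integrable (fun g : G => g • f (g⁻¹ • z)) μ := fun z =>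
    (hcont z).integrable_of_hasCompactSupport (HasCompactSupport.of_compactSpace _)
  refine ⟨fun z => ∫ g : G, g • f (g⁻¹ • z) ∂μ, ?_, ?_, ?_⟩
  -- Currying into `C(G, E)`, with its sup metric by compactness of `G`, makes the continuity in `z`
  -- uniform in `g`.
  · let c : C(Z × G, E) := ⟨fun p => p.2 • f (p.2⁻¹ • p.1), by fun_prop⟩
    rw [continuous_iff_continuousAt]
    intro z₀
    have h0 : Tendsto (fun z => dist (c.curry z) (c.curry z₀)) (𝓝 z₀) (𝓝 0) :=
      tendsto_iff_dist_tendsto_zero.1 (c.curry.continuous.tendsto z₀)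
    refine tendsto_iff_dist_tendsto_zero.2
      (squeeze_zero (fun _ => dist_nonneg) (fun z => ?_) h0)
    rw [dist_eq_norm, ← integral_sub (hint z) (hint z₀)]
    have h1 : ∀ g : G, ‖g • f (g⁻¹ • z) - g • f (g⁻¹ • z₀)‖ ≤ dist (c.curry z) (c.curry z₀) :=
      fun g => by
        rw [← dist_eq_norm]
        exact ContinuousMap.dist_apply_le_dist (f := c.curry z) (g := c.curry z₀) g
    simpa using norm_integral_le_of_norm_le_const (μ := μ) (Eventually.of_forall h1)
  · intro h z
    let L : E →L[ℝ] E :=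
      { toFun := fun x => h • x
        map_add' := smul_add h
        map_smul' := fun r x => smul_comm h r x
        cont := continuous_const_smul h }
    have h1 : (∫ g : G, L (g • f (g⁻¹ • z)) ∂μ) = L (∫ g : G, g • f (g⁻¹ • z) ∂μ) :=
      L.integral_comp_comm (hint z)
    have h2 := integral_mul_left_eq_self (μ := μ) (fun g : G => g • f (g⁻¹ • h • z)) h
    change (∫ g : G, g • f (g⁻¹ • h • z) ∂μ) = L (∫ g : G, g • f (g⁻¹ • z) ∂μ)
    rw [← h1, ← h2]
    congr 1
    ext g
    simp [L, mul_smul]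
  · intro z C hC hCc h
    exact hC.integral_mem hCc (Eventually.of_forall h) (hint z)

end Average

/-! ### Elementary properties of the index -/

section Index

variable {G : Type*} [Group G] {X : Type*} [NormedAddCommGroup X] [DistribMulAction G X]

theorem InvariantSet.smul_mem {Z : Type*} [MulAction G Z] {A : Set Z} (hA : InvariantSet G A)
    (g : G) {x : Z} (hx : x ∈ A) : g • x ∈ A := by
  rw [← hA g]
  exact ⟨x, hx, rfl⟩

theorem invariantSet_of_smul_mem {Z : Type*} [MulAction G Z] {A : Set Z}
    (h : ∀ (g : G), ∀ x ∈ A, g • x ∈ A) : InvariantSet G A := by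
  intro g
  apply Set.Subset.antisymm
  · rintro _ ⟨x, hx, rfl⟩
    exact h g x hx
  · intro x hx
    exact ⟨g⁻¹ • x, h _ x hx, smul_inv_smul g x⟩

variable (G) (Y : Type*) [NormedAddCommGroup Y] [DistribMulAction G Y]

/-- There is a continuous equivariant map `A → Yᵏ \ {0}`. -/
def HasIndexMap (A : Set X) (k : ℕ) : Prop :=
  ∃ φ : X → (Fin k → Y), EquivariantMapOn G φ A ∧ ∀ x ∈ A, φ x ≠ 0

variable {G Y}

theorem HasIndexMap.comp {A B : Set X} {k : ℕ} (hB : HasIndexMap G Y B k) {η : X → X}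
    (hη : EquivariantMapOn G η A) (hAB : Set.MapsTo η A B) : HasIndexMap G Y A k := by
  obtain ⟨φ, ⟨hc, he⟩, h0⟩ := hB
  refine ⟨φ ∘ η, ⟨hc.comp hη.1 hAB, fun g x hx => ?_⟩, fun x hx => h0 _ (hAB hx)⟩
  simp only [Function.comp_apply, hη.2 g x hx, he g _ (hAB hx)]

theorem HasIndexMap.mono {A B : Set X} {k : ℕ} (hB : HasIndexMap G Y B k) (hAB : A ⊆ B) :
    HasIndexMap G Y A k :=
  hB.comp (η := id) ⟨continuousOn_id, fun _ _ _ => rfl⟩ hAB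

theorem hasIndexMap_empty (k : ℕ) : HasIndexMap G Y (∅ : Set X) k :=
  ⟨fun _ => 0, ⟨continuousOn_empty _, fun _ _ h => h.elim⟩, fun _ h => h.elim⟩

theorem HasIndexMap.eq_empty {A : Set X} (h : HasIndexMap G Y A 0) : A = ∅ := by
  obtain ⟨φ, -, h0⟩ := h
  exact Set.eq_empty_of_forall_notMem fun x hx => h0 x hx (Subsingleton.elim _ _)

theorem continuousOn_fin_append {k l : ℕ} {A : Set X} {φ : X → Fin k → Y} {ψ : X → Fin l → Y}
    (hφ : ContinuousOn φ A) (hψ : ContinuousOn ψ A) :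
    ContinuousOn (fun x => Fin.append (φ x) (ψ x)) A := by
  rw [continuousOn_pi] at *
  intro i
  refine Fin.addCases (fun i => ?_) (fun i => ?_) i
  · simpa using hφ i
  · simpa using hψ i

theorem fin_append_smul {k l : ℕ} (g : G) (a : Fin k → Y) (b : Fin l → Y) :
    Fin.append (g • a) (g • b) = g • Fin.append a b := by
  ext i
  refine Fin.addCases (fun i => ?_) (fun i => ?_) i <;> simp

theorem fin_append_eq_zero {k l : ℕ} {a : Fin k → Y} {b : Fin l → Y}
    (h : Fin.append a b = 0) : a = 0 ∧ b = 0 := by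
  constructor
  · ext i
    simpa using congrFun h (Fin.castAdd l i)
  · ext i
    simpa using congrFun h (Fin.natAdd k i)

theorem EquivariantMapOn.fin_append {k l : ℕ} {A : Set X} {φ : X → Fin k → Y}
    {ψ : X → Fin l → Y} (hφ : EquivariantMapOn G φ A) (hψ : EquivariantMapOn G ψ A) :
    EquivariantMapOn G (fun x => Fin.append (φ x) (ψ x)) A :=
  ⟨continuousOn_fin_append hφ.1 hψ.1, fun g x hx => by
    simp only [hφ.2 g x hx, hψ.2 g x hx, fin_append_smul]⟩

theorem HasIndexMap.mono_right {A : Set X} {k l : ℕ} (h : HasIndexMap G Y A k) (hkl : k ≤ l) :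
    HasIndexMap G Y A l := by
  obtain ⟨m, rfl⟩ := Nat.exists_eq_add_of_le hkl
  obtain ⟨φ, hφ, h0⟩ := h
  have hz : EquivariantMapOn G (fun _ : X => (0 : Fin m → Y)) A :=
    ⟨continuousOn_const, fun g x _ => (smul_zero g).symm⟩
  exact ⟨_, hφ.fin_append hz, fun x hx h => h0 x hx (fin_append_eq_zero h).1⟩

/-- Padding by zeros makes the admissible dimensions upward closed. Since `Y⁰` is a point,
`HasIndexMap` with `k = 0` forces emptiness, which matches the convention for the empty set. -/
theorem gIndex_le_iff {A : Set X} {k : ℕ} : gIndex G Y A ≤ k ↔ HasIndexMap G Y A k := by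
  unfold gIndex
  split_ifs with hA
  · subst hA
    simpa using hasIndexMap_empty k
  · constructor
    · intro h
      by_contra hk
      have : ((k + 1 : ℕ) : ℕ∞) ≤ k := by
        refine le_trans (le_sInf ?_) h
        rintro _ ⟨m, -, rfl, hm⟩
        by_contra hlt
        rw [Nat.cast_le, not_le, Nat.lt_succ_iff] at hlt
        exact hk (HasIndexMap.mono_right hm hlt)
      rw [Nat.cast_le] at this
      omega
    · intro h
      rcases Nat.eq_zero_or_pos k with rfl | hk
      · exact (hA h.eq_empty).elim
      · exact sInf_le ⟨k, hk, rfl, h⟩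

theorem natCast_le_gIndex_iff {A : Set X} {j : ℕ} :
    (j : ℕ∞) ≤ gIndex G Y A ↔ ∀ k < j, ¬ HasIndexMap G Y A k := by
  constructor
  · intro h k hk hm
    have := h.trans (gIndex_le_iff.2 hm)
    rw [Nat.cast_le] at this
    omega
  · intro h
    by_contra hlt
    rw [not_le] at hlt
    obtain ⟨k, hk⟩ := ENat.ne_top_iff_exists.1 hlt.ne_top
    rw [← hk, Nat.cast_lt] at hlt
    exact h k hlt (gIndex_le_iff.1 hk.ge)

end Index

/-! ### Equivariant extension, subadditivity and continuity of the index -/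

section Extension

variable {G : Type*} [Group G] [TopologicalSpace G] [IsTopologicalGroup G] [CompactSpace G]
  {X : Type*} [NormedAddCommGroup X] [DistribMulAction G X] [ContinuousSMul G X]
  {Y : Type*} [NormedAddCommGroup Y] [NormedSpace ℝ Y] [FiniteDimensional ℝ Y]
  [DistribMulAction G Y] [SMulCommClass G ℝ Y] [ContinuousSMul G Y]

/-- Equivariant Tietze extension theorem. -/
theorem EquivariantMapOn.exists_extension {A : Set X} (hA : InvariantSet G A) (hAc : IsClosed A)
    {k : ℕ} {φ : X → Fin k → Y} (hφ : EquivariantMapOn G φ A) :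
    ∃ F : X → Fin k → Y, Continuous F ∧ (∀ (g : G) (x : X), F (g • x) = g • F x) ∧
      Set.EqOn F φ A := by
  have : CompleteSpace Y := FiniteDimensional.complete ℝ Y
  obtain ⟨f, hf⟩ := ContinuousMap.exists_restrict_eq hAc
    (⟨A.domRestrict φ, continuousOn_iff_continuous_domRestrict.1 hφ.1⟩ : C(A, Fin k → Y))
  have hfA : ∀ x ∈ A, f x = φ x := fun x hx => congrArg (fun h : C(A, Fin k → Y) => h ⟨x, hx⟩) hf
  obtain ⟨F, hF, hFe, hFC⟩ := exists_equivariant_average (G := G) f.continuous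
  -- On `A` the averaged integrand is constantly `φ x`, so averaging does not change the values
  -- there.
  refine ⟨F, hF, hFe, fun x hx => hFC x {φ x} (convex_singleton _) isClosed_singleton fun g => ?_⟩
  rw [Set.mem_singleton_iff, hfA _ (hA.smul_mem g⁻¹ hx), ← hφ.2 g _ (hA.smul_mem g⁻¹ hx),
    smul_inv_smul]

/-- Extend both maps equivariantly to `X` and concatenate them: on each piece one component is
nonzero. -/
theorem HasIndexMap.union {A B : Set X} (hA : InvariantSet G A) (hAc : IsClosed A)
    (hB : InvariantSet G B) (hBc : IsClosed B) {k l : ℕ} (hk : HasIndexMap G Y A k)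
    (hl : HasIndexMap G Y B l) : HasIndexMap G Y (A ∪ B) (k + l) := by
  obtain ⟨φ, hφ, hφ0⟩ := hk
  obtain ⟨ψ, hψ, hψ0⟩ := hl
  obtain ⟨F, hF, hFe, hFφ⟩ := hφ.exists_extension hA hAc
  obtain ⟨H, hH, hHe, hHψ⟩ := hψ.exists_extension hB hBc
  have h1 : EquivariantMapOn G F (A ∪ B) := ⟨hF.continuousOn, fun g x _ => hFe g x⟩
  have h2 : EquivariantMapOn G H (A ∪ B) := ⟨hH.continuousOn, fun g x _ => hHe g x⟩
  refine ⟨_, h1.fin_append h2, ?_⟩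
  rintro x (hx | hx) h
  · exact hφ0 x hx (hFφ hx ▸ (fin_append_eq_zero h).1)
  · exact hψ0 x hx (hHψ hx ▸ (fin_append_eq_zero h).2)

theorem HasIndexMap.exists_isOpen {A : Set X} (hA : InvariantSet G A) (hAc : IsClosed A) {k : ℕ}
    (hk : HasIndexMap G Y A k) : ∃ U : Set X, IsOpen U ∧ A ⊆ U ∧ HasIndexMap G Y U k := by
  obtain ⟨φ, hφ, hφ0⟩ := hk
  obtain ⟨F, hF, hFe, hFφ⟩ := hφ.exists_extension hA hAc
  exact ⟨{x | F x ≠ 0}, isOpen_ne_fun hF continuous_const, fun x hx h => hφ0 x hx (hFφ hx ▸ h),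
    F, ⟨hF.continuousOn, fun g x _ => hFe g x⟩, fun x hx => hx⟩

end Extension

/-! ### Ekeland's variational principle -/

section Ekeland

/-- Ekeland's variational principle. -/
theorem exists_ekeland {M : Type*} [MetricSpace M] [CompleteSpace M] {f : M → ℝ}
    (hf : LowerSemicontinuous f) (hb : BddBelow (Set.range f)) {ε : ℝ} (hε : 0 < ε) (x₀ : M) :
    ∃ x, f x + ε * dist x₀ x ≤ f x₀ ∧ ∀ y, f x ≤ f y + ε * dist x y := by
  let S : M → Set M := fun x => {y | f y + ε * dist x y ≤ f x}
  have hSself : ∀ x, x ∈ S x := fun x => by simp [S]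
  have hStrans : ∀ x y z, y ∈ S x → z ∈ S y → z ∈ S x := by
    intro x y z hy hz
    have h1 : f y + ε * dist x y ≤ f x := hy
    have h2 : f z + ε * dist y z ≤ f y := hz
    have h3 := mul_le_mul_of_nonneg_left (dist_triangle x y z) hε.le
    change f z + ε * dist x z ≤ f x
    linarith
  have hSclosed : ∀ x, IsClosed (S x) := fun x =>
    (hf.add (by fun_prop : Continuous fun y => ε * dist x y).lowerSemicontinuous).isClosed_preimage
      (f x)
  have hbS : ∀ x, BddBelow (f '' S x) := fun x => hb.mono (Set.image_subset_range _ _)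
  have hnext : ∀ (x : M) (n : ℕ), ∃ y ∈ S x, ∀ z ∈ S x, f y ≤ f z + (1 / 2 : ℝ) ^ n := by
    intro x n
    have hne : (f '' S x).Nonempty := ⟨f x, x, hSself x, rfl⟩
    obtain ⟨_, ⟨y, hy, rfl⟩, hlt⟩ := Real.lt_sInf_add_pos hne (by positivity : 0 < (1 / 2 : ℝ) ^ n)
    exact ⟨y, hy, fun z hz => hlt.le.trans (by gcongr; exact csInf_le (hbS x) ⟨z, hz, rfl⟩)⟩
  choose next hnextS hnext using hnext
  let x : ℕ → M := fun n => Nat.rec x₀ (fun k y => next y k) n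
  have hx : ∀ n, x (n + 1) = next (x n) n := fun n => rfl
  have hmem : ∀ n m, n ≤ m → x m ∈ S (x n) := by
    intro n m h
    induction m, h using Nat.le_induction with
    | base => exact hSself _
    | succ m _ ih => exact hStrans _ _ _ ih (hnextS _ _)
  -- Each `x (n + 1)` almost minimizes `f` on `S (x n)`, so the nested sets `S (x n)` shrink to a
  -- point.
  have hdist : ∀ n, ∀ y ∈ S (x (n + 1)), dist (x (n + 1)) y ≤ (1 / 2 : ℝ) ^ n / ε := by
    intro n y hy
    have h1 : f y + ε * dist (x (n + 1)) y ≤ f (x (n + 1)) := hy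
    have h2 := hnext (x n) n y (hStrans _ _ _ (hmem n (n + 1) n.le_succ) hy)
    rw [← hx] at h2
    rw [le_div_iff₀ hε]
    linarith
  have hlim : Tendsto (fun n : ℕ => (1 / 2 : ℝ) ^ n / ε) atTop (𝓝 0) := by
    simpa using (tendsto_pow_atTop_nhds_zero_of_lt_one (by norm_num : (0 : ℝ) ≤ 1 / 2)
      (by norm_num)).div_const ε
  have hcau : CauchySeq fun n => x (n + 1) := by
    refine cauchySeq_of_le_tendsto_0' _ (fun n m hnm => ?_) hlim
    exact hdist n _ (hmem (n + 1) (m + 1) (by omega))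
  obtain ⟨a, ha⟩ := cauchySeq_tendsto_of_complete hcau
  have haS : ∀ n, a ∈ S (x n) := fun n =>
    (hSclosed _).mem_of_tendsto ha (eventually_atTop.2 ⟨n, fun m hm => hmem n (m + 1) (by omega)⟩)
  refine ⟨a, haS 0, fun y => ?_⟩
  by_contra hlt
  rw [not_le] at hlt
  -- A violating `y` lies in `S a`, hence in every `S (x n)`, and so must equal the limit `a`.
  have hy : Tendsto (fun n => x (n + 1)) atTop (𝓝 y) :=
    tendsto_iff_dist_tendsto_zero.2 (squeeze_zero (fun _ => dist_nonneg)
      (fun n => hdist n y (hStrans _ _ _ (haS (n + 1)) hlt.le)) hlim)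
  rw [tendsto_nhds_unique ha hy] at hlt
  simp at hlt

/-- Ekeland's variational principle on a closed set, for extended real valued functionals. -/
theorem exists_ekeland_of_isClosed {M : Type*} [MetricSpace M] [CompleteSpace M] {f : M → EReal}
    (hf : LowerSemicontinuous f) {S : Set M} (hS : IsClosed S) {x₀ : M} (hx₀ : x₀ ∈ S) {m ε r : ℝ}
    (hε : 0 < ε) (hm : ∀ x ∈ S, (m : EReal) ≤ f x) (hfx₀ : f x₀ ≤ ((m + ε * r : ℝ) : EReal)) :
    ∃ x ∈ S, dist x₀ x ≤ r ∧ ∃ p : ℝ, f x = p ∧ f x ≤ f x₀ ∧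
      ∀ y ∈ S, ∀ q : ℝ, f y ≤ q → p ≤ q + ε * dist x y := by
  -- On this closed sublevel set `f` is finite; competitors outside it have larger values and
  -- satisfy the inequality trivially.
  let T : Set M := S ∩ f ⁻¹' Set.Iic (f x₀)
  have hT : IsClosed T := hS.inter (hf.isClosed_preimage _)
  have : CompleteSpace T := hT.completeSpace_coe
  have hreal : ∀ x : T, ((f x).toReal : EReal) = f x := fun x =>
    EReal.coe_toReal (ne_top_of_le_ne_top (EReal.coe_ne_top _) (x.2.2.trans hfx₀))
      (ne_bot_of_le_ne_bot (EReal.coe_ne_bot m) (hm _ x.2.1))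
  have hlsc : LowerSemicontinuous fun x : T => (f x).toReal := by
    intro x y hy
    have hy' : (y : EReal) < f x := by rw [← hreal x]; exact_mod_cast hy
    filter_upwards [continuous_subtype_val.continuousAt.eventually (hf x y hy')] with z hz
    rw [← hreal z] at hz
    exact_mod_cast hz
  have hm' : ∀ x : T, m ≤ (f x).toReal := fun x => by
    have := hm _ x.2.1
    rw [← hreal x] at this
    exact_mod_cast this
  obtain ⟨x, hx1, hx2⟩ := exists_ekeland hlsc
    ⟨m, by rintro _ ⟨x, rfl⟩; exact hm' x⟩ hε ⟨x₀, hx₀, le_refl (f x₀)⟩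
  refine ⟨x, x.2.1, ?_, _, (hreal x).symm, x.2.2, fun y hy q hq => ?_⟩
  · have h1 : (f x₀).toReal ≤ m + ε * r := by
      rw [← hreal ⟨x₀, hx₀, le_refl (f x₀)⟩] at hfx₀
      exact_mod_cast hfx₀
    have h2 := hm' x
    refine le_of_mul_le_mul_left ?_ hε
    have h3 : dist (⟨x₀, hx₀, le_refl (f x₀)⟩ : T) x = dist x₀ (x : M) := rfl
    rw [h3] at hx1
    linarith
  · by_cases hyT : f y ≤ f x₀
    · have h1 := hx2 ⟨y, hy, hyT⟩
      have h2 : (f y).toReal ≤ q := by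
        rw [← hreal ⟨y, hy, hyT⟩] at hq
        exact_mod_cast hq
      have h3 : dist x (⟨y, hy, hyT⟩ : T) = dist (x : M) y := rfl
      rw [h3] at h1
      linarith
    · have h1 : f x ≤ q := x.2.2.trans ((not_le.1 hyT).le.trans hq)
      rw [← hreal x] at h1
      have h2 : (f x).toReal ≤ q := by exact_mod_cast h1
      have := mul_nonneg hε.le (dist_nonneg (x := (x : M)) (y := y))
      linarith

end Ekeland

/-! ### The families `Γ_j` in the Hausdorff metric -/

section Hausdorff

variable {X : Type*} [NormedAddCommGroup X]

theorem exists_dist_lt_of_nonemptyCompacts {A B : NonemptyCompacts X} {r : ℝ} (h : dist A B < r)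
    {x : X} (hx : x ∈ (A : Set X)) : ∃ y ∈ (B : Set X), dist x y < r :=
  Metric.exists_dist_lt_of_hausdorffDist_lt hx (by rwa [← Metric.NonemptyCompacts.dist_eq])
    (Metric.hausdorffEDist_ne_top_of_nonempty_of_bounded A.nonempty B.nonempty
      A.isCompact.isBounded B.isCompact.isBounded)

/-- A point `u` of `A` with `f u > y` is approximated by points of any set close to `A`, where `f`
still exceeds `y`. -/
theorem lowerSemicontinuous_iSup_nonemptyCompacts {f : X → EReal} (hf : LowerSemicontinuous f) :
    LowerSemicontinuous fun A : NonemptyCompacts X => ⨆ u ∈ (A : Set X), f u := by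
  intro A y hy
  simp only [lt_iSup_iff] at hy
  obtain ⟨u, hu, hyu⟩ := hy
  obtain ⟨r, hr, hball⟩ := Metric.eventually_nhds_iff.1 (hf u y hyu)
  filter_upwards [Metric.ball_mem_nhds A hr] with B hB
  obtain ⟨v, hv, huv⟩ := exists_dist_lt_of_nonemptyCompacts (Metric.mem_ball'.1 hB) hu
  exact (hball (dist_comm u v ▸ huv)).trans_le
    (le_iSup₂ (f := fun u (_ : u ∈ (B : Set X)) => f u) v hv)

variable {G : Type*} [Group G] [DistribMulAction G X]
  {Y : Type*} [NormedAddCommGroup Y] [DistribMulAction G Y]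

theorem mem_gammaFamily {A : NonemptyCompacts X} {j : ℕ} (hA : InvariantSet G (A : Set X))
    (h0 : (0 : X) ∉ (A : Set X)) (hj : (j : ℕ∞) ≤ gIndex G Y (A : Set X)) :
    A ∈ GammaFamily (X := X) G Y j :=
  subset_closure ⟨hA, h0, hj⟩

theorem gammaFamily_anti : Antitone (GammaFamily (X := X) G Y) := fun _ _ hij =>
  closure_mono fun _ hA => ⟨hA.1, hA.2.1, le_trans (by exact_mod_cast hij) hA.2.2⟩

theorem gammaFamily_zero : GammaFamily (X := X) G Y 0 = GammaFamily (X := X) G Y 1 := by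
  refine le_antisymm (closure_mono fun A hA => ⟨hA.1, hA.2.1, ?_⟩) (gammaFamily_anti zero_le_one)
  rw [natCast_le_gIndex_iff]
  intro k hk h
  obtain rfl : k = 0 := by omega
  exact A.nonempty.ne_empty h.eq_empty

theorem minimaxValue_monotone {Φ : X → ℝ} {Ψ : X → EReal} :
    Monotone (minimaxValue G Y Φ Ψ) := fun _ _ hij =>
  biInf_mono fun _ hA => gammaFamily_anti hij hA

theorem minimaxValue_lt_of_exists {Φ : X → ℝ} {Ψ : X → EReal} {j : ℕ} {q : EReal}
    (h : ∃ A : Set X, SigmaClass G A ∧ A.Nonempty ∧ IsCompact A ∧ (j : ℕ∞) ≤ gIndex G Y A ∧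
      ⨆ u ∈ A, energy Φ Ψ u < q) : minimaxValue G Y Φ Ψ j < q := by
  obtain ⟨A, hA, hne, hAc, hj, hlt⟩ := h
  let B : NonemptyCompacts X := ⟨⟨A, hAc⟩, hne⟩
  have hB : B ∈ GammaFamily (X := X) G Y j := mem_gammaFamily hA.1 hA.2.2 hj
  exact (iInf₂_le B hB).trans_lt hlt

theorem InvariantSet.of_mem_gammaFamily (hiso : ∀ (g : G) (x : X), ‖g • x‖ = ‖x‖)
    {A : NonemptyCompacts X} {j : ℕ} (hA : A ∈ GammaFamily (X := X) G Y j) :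
    InvariantSet G (A : Set X) := by
  refine invariantSet_of_smul_mem fun g x hx => ?_
  rw [← A.isCompact.isClosed.closure_eq, Metric.mem_closure_iff]
  intro r hr
  obtain ⟨B, hB, hAB⟩ := Metric.mem_closure_iff.1 hA (r / 2) (half_pos hr)
  obtain ⟨y, hy, hxy⟩ := exists_dist_lt_of_nonemptyCompacts hAB hx
  obtain ⟨z, hz, hyz⟩ := exists_dist_lt_of_nonemptyCompacts (dist_comm A B ▸ hAB)
    (hB.1.smul_mem g hy)
  refine ⟨z, hz, ?_⟩
  have h1 : dist (g • x) (g • y) = dist x y := by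
    rw [dist_eq_norm, dist_eq_norm, ← smul_sub, hiso]
  have := dist_triangle (g • x) (g • y) z
  linarith

variable [TopologicalSpace G] [IsTopologicalGroup G] [CompactSpace G] [ContinuousSMul G X]
  [NormedSpace ℝ Y] [FiniteDimensional ℝ Y] [SMulCommClass G ℝ Y] [ContinuousSMul G Y]

/-- The index estimate survives passing to the Hausdorff closure. -/
theorem le_gIndex_of_mem_gammaFamily (hiso : ∀ (g : G) (x : X), ‖g • x‖ = ‖x‖)
    {A : NonemptyCompacts X} {j : ℕ} (hA : A ∈ GammaFamily (X := X) G Y j) :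
    (j : ℕ∞) ≤ gIndex G Y (A : Set X) := by
  rw [natCast_le_gIndex_iff]
  intro k hk h
  obtain ⟨U, hU, hAU, hUk⟩ :=
    h.exists_isOpen (InvariantSet.of_mem_gammaFamily hiso hA) A.isCompact.isClosed
  obtain ⟨r, hr, hrU⟩ := A.isCompact.exists_thickening_subset_open hU hAU
  obtain ⟨B, hB, hAB⟩ := Metric.mem_closure_iff.1 hA r hr
  refine natCast_le_gIndex_iff.1 hB.2.2 k hk (hUk.mono fun x hx => hrU ?_)
  obtain ⟨y, hy, hxy⟩ := exists_dist_lt_of_nonemptyCompacts (dist_comm A B ▸ hAB) hx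
  exact Metric.mem_thickening_iff.2 ⟨y, hy, hxy⟩

end Hausdorff

/-! ### Critical points and the Palais–Smale condition -/

section CriticalPoints

variable {X : Type*} [NormedAddCommGroup X] [NormedSpace ℝ X] {Φ : X → ℝ} {Ψ : X → EReal}

theorem ClassH0.exists_coe (hI : ClassH0 Φ Ψ) {u : X} (hu : Ψ u ≠ ⊤) : ∃ a : ℝ, Ψ u = a :=
  ⟨(Ψ u).toReal, (EReal.coe_toReal hu (hI.ne_bot u)).symm⟩

theorem energy_of_eq_coe {Z : Type*} {Φ : Z → ℝ} {Ψ : Z → EReal} {u : Z} {a : ℝ} (h : Ψ u = a) :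
    energy Φ Ψ u = ((Φ u + a : ℝ) : EReal) := by
  rw [energy, h, EReal.coe_add]

theorem ClassH0.exists_coe_of_energy_lt_top (hI : ClassH0 Φ Ψ) {u : X}
    (hu : energy Φ Ψ u < ⊤) : ∃ a : ℝ, Ψ u = a := by
  refine hI.exists_coe fun h => ?_
  simp [energy, h] at hu

theorem LowerSemicontinuous.coe_add_ereal {Z : Type*} [TopologicalSpace Z] {f : Z → ℝ}
    {ψ : Z → EReal} (hf : Continuous f) (hψ : LowerSemicontinuous ψ) :
    LowerSemicontinuous fun z => (f z : EReal) + ψ z :=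
  LowerSemicontinuous.add' (continuous_coe_real_ereal.comp hf).lowerSemicontinuous hψ fun _ =>
    EReal.continuousAt_add (Or.inl (EReal.coe_ne_top _)) (Or.inl (EReal.coe_ne_bot _))

theorem ClassH0.lowerSemicontinuous_energy (hI : ClassH0 Φ Ψ) :
    LowerSemicontinuous (energy Φ Ψ) :=
  LowerSemicontinuous.coe_add_ereal hI.contDiff.continuous hI.lsc

theorem ClassH0.continuous_fderiv (hI : ClassH0 Φ Ψ) : Continuous (fderiv ℝ Φ) :=
  hI.contDiff.continuous_fderiv one_ne_zero

theorem ClassH0.coe_le_add_sub_iff (hI : ClassH0 Φ Ψ) {u v : X} {a t d : ℝ} (ha : Ψ u = a) :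
    (t : EReal) ≤ (d : EReal) + (Ψ v - Ψ u) ↔ ∀ b : ℝ, Ψ v = b → t ≤ d + (b - a) := by
  rw [ha]
  constructor
  · intro h b hb
    rw [hb] at h
    exact_mod_cast h
  · intro h
    by_cases hv : Ψ v = ⊤
    · rw [hv, EReal.top_sub_coe, EReal.coe_add_top]
      exact le_top
    · obtain ⟨b, hb⟩ := hI.exists_coe hv
      rw [hb]
      exact_mod_cast h b hb

theorem ClassH0.isCriticalPoint_of_coe (hI : ClassH0 Φ Ψ) {u : X} {a : ℝ} (ha : Ψ u = a)
    (h : ∀ (v : X) (b : ℝ), Ψ v = b → 0 ≤ fderiv ℝ Φ u (v - u) + (b - a)) :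
    IsCriticalPoint Φ Ψ u := by
  refine ⟨by rw [energy_of_eq_coe ha]; exact EReal.coe_lt_top _, fun v => ?_⟩
  exact_mod_cast (hI.coe_le_add_sub_iff (t := 0) ha).2 (h v)

/-- Limits of Palais–Smale sequences at level `c` are critical points at level `c`. -/
theorem IsPSSequence.isCriticalPoint_of_tendsto (hI : ClassH0 Φ Ψ) {c : ℝ} {u : ℕ → X}
    (hu : IsPSSequence Φ Ψ c u) {σ : ℕ → ℕ} (hσ : StrictMono σ) {x : X}
    (hx : Tendsto (u ∘ σ) atTop (𝓝 x)) : IsCriticalPoint Φ Ψ x ∧ energy Φ Ψ x = c := by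
  obtain ⟨hfin, hlev, ε, -, hε, hslope⟩ := hu
  choose a ha using fun n => hI.exists_coe_of_energy_lt_top (hfin n)
  have hΦ : Tendsto (fun n => Φ (u (σ n))) atTop (𝓝 (Φ x)) :=
    (hI.contDiff.continuous.tendsto x).comp hx
  have hsum : Tendsto (fun n => Φ (u (σ n)) + a (σ n)) atTop (𝓝 c) := by
    rw [← EReal.tendsto_coe]
    exact (hlev.comp hσ.tendsto_atTop).congr fun n => energy_of_eq_coe (ha (σ n))
  have hlim : Tendsto (fun n => a (σ n)) atTop (𝓝 (c - Φ x)) :=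
    (hsum.sub hΦ).congr fun n => by ring
  have hle : Ψ x ≤ ((c - Φ x : ℝ) : EReal) := by
    by_contra hlt
    obtain ⟨z, hz1, hz2⟩ := EReal.lt_iff_exists_real_btwn.1 (not_le.1 hlt)
    have h1 : ∀ᶠ n in atTop, z ≤ a (σ n) := by
      filter_upwards [hx.eventually (hI.lsc x z hz2)] with n hn
      rw [Function.comp_apply, ha] at hn
      exact_mod_cast hn.le
    exact absurd (ge_of_tendsto hlim h1) (not_le.2 (by exact_mod_cast hz1))
  obtain ⟨b, hb⟩ := hI.exists_coe (ne_top_of_le_ne_top (EReal.coe_ne_top _) hle)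
  have hbc : b ≤ c - Φ x := by rw [hb] at hle; exact_mod_cast hle
  have key : ∀ (v : X) (d : ℝ), Ψ v = d → 0 ≤ fderiv ℝ Φ x (v - x) + (d - (c - Φ x)) := by
    intro v d hd
    have hvx : Tendsto (fun n => v - u (σ n)) atTop (𝓝 (v - x)) := tendsto_const_nhds.sub hx
    have h1 : Tendsto (fun n => -(ε (σ n) * ‖v - u (σ n)‖)) atTop (𝓝 0) := by
      simpa using ((hε.comp hσ.tendsto_atTop).mul hvx.norm).neg
    have hD : Continuous fun y => fderiv ℝ Φ y (v - y) :=
      hI.continuous_fderiv.clm_apply (continuous_const.sub continuous_id)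
    have h2 : Tendsto (fun n => fderiv ℝ Φ (u (σ n)) (v - u (σ n)) + (d - a (σ n))) atTop
        (𝓝 (fderiv ℝ Φ x (v - x) + (d - (c - Φ x)))) :=
      ((hD.tendsto x).comp hx).add (hlim.const_sub d)
    exact le_of_tendsto_of_tendsto' h1 h2 fun n =>
      (hI.coe_le_add_sub_iff (ha (σ n))).1 (hslope (σ n) v) d hd
  -- Lower semicontinuity gives only `≤`; testing the limit inequality with `v = x` gives the
  -- converse, so the level is exactly `c`.
  have hbc' : b = c - Φ x := le_antisymm hbc (by simpa using key x b hb)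
  subst hbc'
  refine ⟨hI.isCriticalPoint_of_coe hb key, ?_⟩
  rw [energy_of_eq_coe hb]
  ring_nf

variable (Φ Ψ) in
/-- The critical points at level `c`. -/
def criticalSet (c : ℝ) : Set X :=
  {u | IsCriticalPoint Φ Ψ u ∧ energy Φ Ψ u = c}

/-- Any sequence in this set is Palais–Smale, with arbitrary `εₙ → 0⁺`. -/
theorem isCompact_criticalSet (hI : ClassH0 Φ Ψ) (hPS : PalaisSmale Φ Ψ) (c : ℝ) :
    IsCompact (criticalSet Φ Ψ c) := by
  refine IsSeqCompact.isCompact fun u hu => ?_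
  have hPSu : IsPSSequence Φ Ψ c u := by
    refine ⟨fun n => (hu n).1.1, ?_, fun n => 1 / ((n : ℝ) + 1), fun n => by positivity,
      tendsto_one_div_add_atTop_nhds_zero_nat, fun n v => le_trans ?_ ((hu n).1.2 v)⟩
    · simp only [(hu _).2]
      exact tendsto_const_nhds
    · have : -(1 / ((n : ℝ) + 1) * ‖v - u n‖) ≤ 0 := neg_nonpos.2 (by positivity)
      exact_mod_cast this
  obtain ⟨x, σ, hσ, hx⟩ := hPS c u hPSu
  exact ⟨x, hPSu.isCriticalPoint_of_tendsto hI hσ hx, σ, hσ, hx⟩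

/-- Away from the critical points at level `c`, the slope is bounded below near that level. -/
theorem exists_uniform_slope (hI : ClassH0 Φ Ψ) (hPS : PalaisSmale Φ Ψ) (c : ℝ) {ρ : ℝ}
    (hρ : 0 < ρ) : ∃ ε > 0, ∀ (u : X) (a : ℝ), Ψ u = a → |Φ u + a - c| ≤ ε →
      u ∉ Metric.thickening ρ (criticalSet Φ Ψ c) →
      ∃ (v : X) (b : ℝ), Ψ v = b ∧ fderiv ℝ Φ u (v - u) + (b - a) < -(ε * ‖v - u‖) := by
  by_contra! H
  have hpos : ∀ n : ℕ, 0 < 1 / ((n : ℝ) + 1) := fun n => by positivity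
  choose u a ha hlev hthick hslope using fun n : ℕ => H _ (hpos n)
  have hlim := tendsto_one_div_add_atTop_nhds_zero_nat (𝕜 := ℝ)
  have hPSu : IsPSSequence Φ Ψ c u := by
    refine ⟨fun n => ?_, ?_, _, hpos, hlim, fun n v =>
      (hI.coe_le_add_sub_iff (ha n)).2 fun b hb => hslope n v b hb⟩
    · rw [energy_of_eq_coe (ha n)]
      exact EReal.coe_lt_top _
    · simp only [fun n => energy_of_eq_coe (Φ := Φ) (ha n), EReal.tendsto_coe]
      exact tendsto_iff_dist_tendsto_zero.2 (squeeze_zero (fun _ => dist_nonneg)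
        (fun n => by rw [Real.dist_eq]; exact hlev n) hlim)
  obtain ⟨x, σ, hσ, hx⟩ := hPS c u hPSu
  have hxK : x ∈ criticalSet Φ Ψ c := hPSu.isCriticalPoint_of_tendsto hI hσ hx
  have h1 : ∀ᶠ n in atTop, (u ∘ σ) n ∈ Metric.thickening ρ (criticalSet Φ Ψ c) :=
    hx.eventually (Metric.isOpen_thickening.mem_nhds (Metric.self_subset_thickening hρ _ hxK))
  obtain ⟨n, hn⟩ := h1.exists
  exact hthick _ hn

end CriticalPoints

/-! ### Descent directions on compact sets -/

section Descent

variable {X : Type*} [NormedAddCommGroup X] [NormedSpace ℝ X] {Φ : X → ℝ} {Ψ : X → EReal}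

/-- `Ψ u` enters with a minus sign, so lower semicontinuity makes the slope towards a fixed `v`
upper semicontinuous in `u`. -/
theorem ClassH0.eventually_slope_lt (hI : ClassH0 Φ Ψ) {u₀ v : X} {a₀ b β : ℝ} (ha₀ : Ψ u₀ = a₀)
    (h : fderiv ℝ Φ u₀ (v - u₀) + (b - a₀) < β) :
    ∀ᶠ u in 𝓝 u₀, ∀ a : ℝ, Ψ u = a → fderiv ℝ Φ u (v - u) + (b - a) < β := by
  obtain ⟨t, ht1, ht2⟩ := exists_between h
  have hc : Continuous fun u => fderiv ℝ Φ u (v - u) :=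
    hI.continuous_fderiv.clm_apply (continuous_const.sub continuous_id)
  have h1 : ∀ᶠ u in 𝓝 u₀, fderiv ℝ Φ u (v - u) < t - (b - a₀) :=
    hc.continuousAt.eventually (gt_mem_nhds (by linarith))
  have h2 : ((a₀ - (β - t) : ℝ) : EReal) < Ψ u₀ := by
    rw [ha₀]
    exact_mod_cast (by linarith : a₀ - (β - t) < a₀)
  filter_upwards [h1, hI.lsc u₀ _ h2] with u hu1 hu2 a ha
  rw [ha] at hu2
  have : a₀ - (β - t) < a := by exact_mod_cast hu2
  linarith

variable (Φ Ψ) in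
/-- The directions `w` in the unit ball along which a step of length `s` from `u` brings the
partially linearized functional `Φ(u) + s Φ'(u) w + Ψ(u + s w)` down to the level `q`. -/
def descentSet (q s : ℝ) (u : X) : Set X :=
  {w | ‖w‖ ≤ 1 ∧ ((Φ u + s * fderiv ℝ Φ u w : ℝ) : EReal) + Ψ (u + s • w) ≤ q}

theorem mem_descentSet_of_coe {q s : ℝ} {u w : X} {b : ℝ} (hw : ‖w‖ ≤ 1)
    (hb : Ψ (u + s • w) ≤ b) (h : Φ u + s * fderiv ℝ Φ u w + b ≤ q) :
    w ∈ descentSet Φ Ψ q s u := by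
  refine ⟨hw, (add_le_add le_rfl hb).trans ?_⟩
  exact_mod_cast h

theorem ClassH0.exists_coe_of_mem_descentSet (hI : ClassH0 Φ Ψ) {q s : ℝ} {u w : X}
    (hw : w ∈ descentSet Φ Ψ q s u) :
    ∃ b : ℝ, Ψ (u + s • w) = b ∧ Φ u + s * fderiv ℝ Φ u w + b ≤ q := by
  obtain ⟨b, hb⟩ : ∃ b : ℝ, Ψ (u + s • w) = b := by
    refine hI.exists_coe fun h => ?_
    have := hw.2
    rw [h, EReal.coe_add_top] at this
    exact EReal.coe_ne_top q (top_le_iff.1 this)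
  refine ⟨b, hb, ?_⟩
  have := hw.2
  rw [hb] at this
  exact_mod_cast this

theorem ClassH0.le_of_coe (hI : ClassH0 Φ Ψ) {u v : X} {a b s t : ℝ} (ha : Ψ u = a)
    (hb : Ψ v = b) (hs : 0 ≤ s) (ht : 0 ≤ t) (hst : s + t = 1) :
    Ψ (s • u + t • v) ≤ ((s * a + t * b : ℝ) : EReal) := by
  rcases hs.eq_or_lt with rfl | hs
  · obtain rfl : t = 1 := by linarith
    simp [hb]
  rcases ht.eq_or_lt with rfl | ht
  · obtain rfl : s = 1 := by linarith
    simp [ha]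
  have := hI.convex u v s t hs ht hst
  rw [ha, hb] at this
  exact_mod_cast this

/-- Convexity is the purpose of linearizing `Φ` but not `Ψ`: it lets descent directions be glued by
partitions of unity and averaged over `G`. -/
theorem ClassH0.convex_descentSet (hI : ClassH0 Φ Ψ) (q s : ℝ) (u : X) :
    Convex ℝ (descentSet Φ Ψ q s u) := by
  intro w₁ h₁ w₂ h₂ a b ha hb hab
  obtain ⟨b₁, hb₁, hq₁⟩ := hI.exists_coe_of_mem_descentSet h₁
  obtain ⟨b₂, hb₂, hq₂⟩ := hI.exists_coe_of_mem_descentSet h₂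
  have hball := convex_closedBall (0 : X) 1 (mem_closedBall_zero_iff.2 h₁.1)
    (mem_closedBall_zero_iff.2 h₂.1) ha hb hab
  refine mem_descentSet_of_coe (mem_closedBall_zero_iff.1 hball) (b := a * b₁ + b * b₂) ?_ ?_
  · have h := hI.le_of_coe hb₁ hb₂ ha hb hab
    have e : u + s • (a • w₁ + b • w₂) = a • (u + s • w₁) + b • (u + s • w₂) := by
      have : u = (a + b) • u := by rw [hab, one_smul]
      nth_rewrite 1 [this]
      module
    rwa [e]
  · have hu : Φ u = a * Φ u + b * Φ u := by rw [← add_mul, hab, one_mul]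
    have hq : q = a * q + b * q := by rw [← add_mul, hab, one_mul]
    rw [map_add, map_smul, map_smul, smul_eq_mul, smul_eq_mul]
    have h1 := mul_le_mul_of_nonneg_left hq₁ ha
    have h2 := mul_le_mul_of_nonneg_left hq₂ hb
    linarith

theorem ClassH0.isClosed_descentSet (hI : ClassH0 Φ Ψ) (q s : ℝ) (u : X) :
    IsClosed (descentSet Φ Ψ q s u) := by
  have h1 : IsClosed {w : X | ‖w‖ ≤ 1} := isClosed_le continuous_norm continuous_const
  have h2 : LowerSemicontinuous fun w : X => Ψ (u + s • w) :=
    hI.lsc.comp (by fun_prop : Continuous fun w : X => u + s • w)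
  have h3 : Continuous fun w : X => Φ u + s * fderiv ℝ Φ u w := by fun_prop
  exact h1.inter ((LowerSemicontinuous.coe_add_ereal h3 h2).isClosed_preimage (q : EReal))

/-- Near a point, moving towards a suitable fixed `v` is a descent direction. -/
theorem ClassH0.exists_local_descent (hI : ClassH0 Φ Ψ) {A : Set X} {c p ε : ℝ} (hε : 0 < ε)
    (hp : c - ε / 4 < p) (hpc : p ≤ c + ε) (hA : ∀ u ∈ A, energy Φ Ψ u ≤ p)
    {u₀ : X} {a₀ : ℝ} (ha₀ : Ψ u₀ = a₀) (hu₀ : Φ u₀ + a₀ ≤ p)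
    (hslope : |Φ u₀ + a₀ - c| ≤ ε →
      ∃ (v : X) (b : ℝ), Ψ v = b ∧ fderiv ℝ Φ u₀ (v - u₀) + (b - a₀) < -(ε * ‖v - u₀‖)) :
    ∃ (v : X) (τ : ℝ), ∀ᶠ z : ℝ × X in 𝓝 (0, u₀), 0 < z.1 → z.2 ∈ A →
      τ • (v - z.2) ∈ descentSet Φ Ψ (p - z.1 * (ε / 4)) z.1 z.2 := by
  obtain ⟨v, τ, b, hτ, hb, hnorm, hhigh⟩ : ∃ (v : X) (τ b : ℝ), 0 < τ ∧ Ψ v = b ∧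
      (∀ᶠ u in 𝓝 u₀, ‖τ • (v - u)‖ ≤ 1) ∧
      ∀ᶠ u in 𝓝 u₀, ∀ a : ℝ, Ψ u = a → c - ε / 2 < Φ u + a →
        τ * (fderiv ℝ Φ u (v - u) + (b - a)) ≤ -(ε / 4) := by
    -- The energy may jump up near a low point `u₀`. Moving back to `u₀` itself then decreases it,
    -- since it drops from above `c - ε / 2` to below `c - ε`.
    by_cases hlow : Φ u₀ + a₀ < c - ε
    · have hN : Continuous fun u : X => ‖(1 : ℝ) • (u₀ - u)‖ := by fun_prop
      have hD : Continuous fun u : X => fderiv ℝ Φ u (u₀ - u) + Φ u :=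
        (hI.continuous_fderiv.clm_apply (continuous_const.sub continuous_id)).add
          hI.contDiff.continuous
      refine ⟨u₀, 1, a₀, one_pos, ha₀, ?_, ?_⟩
      · exact (hN.continuousAt.eventually (gt_mem_nhds (by simp))).mono fun u hu => le_of_lt hu
      · have h1 : ∀ᶠ u in 𝓝 u₀, fderiv ℝ Φ u (u₀ - u) + Φ u < Φ u₀ + ε / 4 :=
          hD.continuousAt.eventually (gt_mem_nhds (by simpa using hε))
        filter_upwards [h1] with u hu a ha hhi
        linarith
    · obtain ⟨v, b, hb, hlt⟩ := hslope (abs_le.2 ⟨by linarith, by linarith⟩)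
      have hd : 0 < ‖v - u₀‖ := by
        refine norm_pos_iff.2 fun h0 => ?_
        obtain rfl : v = u₀ := sub_eq_zero.1 h0
        have hab : b = a₀ := by
          rw [hb] at ha₀
          exact_mod_cast ha₀
        simp [hab] at hlt
      -- This factor gives the direction norm `1 / 2` at `u₀`, hence at most `1` nearby, and slope
      -- at most `-ε / 2`.
      have hτ : 0 < 1 / (2 * ‖v - u₀‖) := by positivity
      refine ⟨v, 1 / (2 * ‖v - u₀‖), b, hτ, hb, ?_, ?_⟩
      · have hN : Continuous fun u : X => ‖(1 / (2 * ‖v - u₀‖)) • (v - u)‖ := by fun_prop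
        refine (hN.continuousAt.eventually (gt_mem_nhds ?_)).mono fun u hu => le_of_lt hu
        change ‖(1 / (2 * ‖v - u₀‖)) • (v - u₀)‖ < 1
        rw [norm_smul, Real.norm_of_nonneg hτ.le]
        field_simp
        norm_num
      · filter_upwards [hI.eventually_slope_lt ha₀ hlt] with u hu a ha _
        have h1 := mul_le_mul_of_nonneg_left (hu a ha).le hτ.le
        have h2 : 1 / (2 * ‖v - u₀‖) * -(ε * ‖v - u₀‖) = -(ε / 2) := by
          field_simp
        linarith
  -- At points of energy at most `c - ε / 2` a crude bound is enough: they lie below `p` by a fixed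
  -- amount, which a short step cannot use up.
  obtain ⟨M, hM0, hM⟩ : ∃ M : ℝ, 0 ≤ M ∧ ∀ᶠ u in 𝓝 u₀, ∀ a : ℝ, Ψ u = a →
      τ * (fderiv ℝ Φ u (v - u) + (b - a)) ≤ M := by
    refine ⟨τ * (|fderiv ℝ Φ u₀ (v - u₀) + (b - a₀)| + 1), by positivity, ?_⟩
    have h1 : fderiv ℝ Φ u₀ (v - u₀) + (b - a₀) <
        |fderiv ℝ Φ u₀ (v - u₀) + (b - a₀)| + 1 := by
      linarith [le_abs_self (fderiv ℝ Φ u₀ (v - u₀) + (b - a₀))]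
    filter_upwards [hI.eventually_slope_lt ha₀ h1] with u hu a ha
    exact mul_le_mul_of_nonneg_left (hu a ha).le hτ.le
  refine ⟨v, τ, ?_⟩
  have hs1 : ∀ᶠ s : ℝ in 𝓝 0, s * τ < 1 :=
    (by fun_prop : Continuous fun s : ℝ => s * τ).continuousAt.eventually (gt_mem_nhds (by simp))
  have hs2 : ∀ᶠ s : ℝ in 𝓝 0, s * (M + ε / 4) < p - (c - ε / 2) :=
    (by fun_prop : Continuous fun s : ℝ => s * (M + ε / 4)).continuousAt.eventually
      (gt_mem_nhds (by linarith))
  rw [nhds_prod_eq]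
  filter_upwards [(hs1.and hs2).prod_mk (hnorm.and (hhigh.and hM))]
  rintro ⟨s, u⟩ ⟨⟨hsτ, hsM⟩, hn, hhi, hMu⟩ hs hu
  dsimp only at *
  have hup := hA u hu
  obtain ⟨a, ha⟩ := hI.exists_coe_of_energy_lt_top (hup.trans_lt (EReal.coe_lt_top p))
  rw [energy_of_eq_coe ha] at hup
  have hup' : Φ u + a ≤ p := by exact_mod_cast hup
  have hconv := hI.le_of_coe ha hb (by linarith : 0 ≤ 1 - s * τ)
    (mul_pos hs hτ).le (by ring)
  -- The new point lies on the segment from `u` to `v`, so convexity controls `Ψ` there.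
  have e : (1 - s * τ) • u + (s * τ) • v = u + s • τ • (v - u) := by module
  rw [e] at hconv
  refine mem_descentSet_of_coe hn hconv ?_
  rw [map_smul, smul_eq_mul]
  have key : Φ u + s * (τ * fderiv ℝ Φ u (v - u)) + ((1 - s * τ) * a + s * τ * b) =
      Φ u + a + s * (τ * (fderiv ℝ Φ u (v - u) + (b - a))) := by ring
  rw [key]
  by_cases h : c - ε / 2 < Φ u + a
  · have := mul_le_mul_of_nonneg_left (hhi a ha h) hs.le
    linarith
  · have := mul_le_mul_of_nonneg_left (hMu a ha) hs.le
    linarith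

/-- A continuous selection of descent directions along a compact set. -/
theorem ClassH0.eventually_exists_selection (hI : ClassH0 Φ Ψ) {A : Set X} (hAc : IsCompact A)
    {c p ε : ℝ} (hε : 0 < ε) (hp : c - ε / 4 < p) (hpc : p ≤ c + ε)
    (hA : ∀ u ∈ A, energy Φ Ψ u ≤ p)
    (hslope : ∀ u ∈ A, ∀ a : ℝ, Ψ u = a → |Φ u + a - c| ≤ ε →
      ∃ (v : X) (b : ℝ), Ψ v = b ∧ fderiv ℝ Φ u (v - u) + (b - a) < -(ε * ‖v - u‖)) :
    ∀ᶠ s in 𝓝[>] (0 : ℝ), ∃ w : X → X, Continuous w ∧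
      ∀ u ∈ A, w u ∈ descentSet Φ Ψ (p - s * (ε / 4)) s u := by
  have hloc : ∀ᶠ s in 𝓝 (0 : ℝ), ∀ u₀ ∈ A, 0 < s → ∃ (v : X) (τ : ℝ), ∀ᶠ u in 𝓝 u₀,
      u ∈ A → τ • (v - u) ∈ descentSet Φ Ψ (p - s * (ε / 4)) s u := by
    -- Compactness of `A` provides one range of step lengths valid at all of its points.
    refine hAc.eventually_forall_of_forall_eventually fun u₀ hu₀ => ?_
    have hup := hA u₀ hu₀
    obtain ⟨a₀, ha₀⟩ := hI.exists_coe_of_energy_lt_top (hup.trans_lt (EReal.coe_lt_top p))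
    rw [energy_of_eq_coe ha₀] at hup
    obtain ⟨v, τ, h⟩ := hI.exists_local_descent hε hp hpc hA ha₀ (by exact_mod_cast hup)
      (hslope u₀ hu₀ a₀ ha₀)
    filter_upwards [h.eventually_nhds] with z hz hs
    refine ⟨v, τ, ?_⟩
    have hc : Continuous fun u : X => (z.1, u) := by fun_prop
    exact (hc.continuousAt (x := z.2)).eventually hz |>.mono fun u hu => hu hs
  filter_upwards [nhdsWithin_le_nhds hloc, self_mem_nhdsWithin] with s hs hs0
  -- No constraint is imposed off `A`, so the selection is defined on all of `X`.
  let T : X → Set X := fun u => {w | u ∈ A → w ∈ descentSet Φ Ψ (p - s * (ε / 4)) s u}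
  have hT : ∀ u, Convex ℝ (T u) := by
    intro u w₁ h₁ w₂ h₂ a b ha hb hab hu
    exact hI.convex_descentSet _ _ _ (h₁ hu) (h₂ hu) ha hb hab
  obtain ⟨w, hw⟩ := exists_continuous_forall_mem_convex_of_local hT (by
    intro u₀
    by_cases hu₀ : u₀ ∈ A
    · obtain ⟨v, τ, h⟩ := hs u₀ hu₀ hs0
      exact ⟨_, h, fun u => τ • (v - u), by fun_prop, fun u hu => hu⟩
    · exact ⟨Aᶜ, hAc.isClosed.isOpen_compl.mem_nhds hu₀, fun _ => 0, continuousOn_const,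
        fun u hu hu' => (hu hu').elim⟩)
  exact ⟨w, w.continuous, fun u hu => hw u hu⟩

/-- First order expansion of a `C¹` function, uniformly on a compact set. -/
theorem eventually_le_linearization (hΦ : ContDiff ℝ 1 Φ) {A : Set X} (hA : IsCompact A) {κ : ℝ}
    (hκ : 0 < κ) : ∀ᶠ s in 𝓝[>] (0 : ℝ), ∀ u ∈ A, ∀ w : X, ‖w‖ ≤ 1 →
      Φ (u + s • w) ≤ Φ u + s * fderiv ℝ Φ u w + s * κ := by
  have hloc : ∀ᶠ s in 𝓝 (0 : ℝ), ∀ u ∈ A, 0 < s → ∀ w : X, ‖w‖ ≤ 1 →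
      Φ (u + s • w) ≤ Φ u + s * fderiv ℝ Φ u w + s * κ := by
    refine hA.eventually_forall_of_forall_eventually fun u₀ _ => ?_
    have h1 := (hΦ.hasStrictFDerivAt (x := u₀) one_ne_zero).isLittleO.def (half_pos hκ)
    obtain ⟨r, hr, hball⟩ := Metric.eventually_nhds_iff.1 h1
    have h2 : ∀ᶠ u in 𝓝 u₀, ‖fderiv ℝ Φ u - fderiv ℝ Φ u₀‖ < κ / 2 := by
      have hc : Continuous fun u => ‖fderiv ℝ Φ u - fderiv ℝ Φ u₀‖ :=
        ((hΦ.continuous_fderiv one_ne_zero).sub continuous_const).norm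
      exact hc.continuousAt.eventually (gt_mem_nhds (by simpa using hκ))
    rw [nhds_prod_eq]
    have h0 : ∀ᶠ s : ℝ in 𝓝 0, s ∈ Metric.ball 0 (r / 2) := Metric.ball_mem_nhds 0 (half_pos hr)
    filter_upwards [h0.prod_mk
      (h2.and (Metric.ball_mem_nhds u₀ (half_pos hr)))]
    rintro ⟨s, u⟩ ⟨hs, hD, hu⟩ hs0 w hw
    dsimp only at *
    have hsw : ‖s • w‖ ≤ s := by
      rw [norm_smul, Real.norm_of_nonneg hs0.le]
      exact mul_le_of_le_one_right hs0.le hw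
    have hs' : s < r / 2 := by simpa [abs_of_pos hs0] using hs
    have hu' : dist u u₀ < r / 2 := hu
    have hsum : dist (u + s • w) u₀ < r := by
      have := dist_triangle (u + s • w) u u₀
      rw [dist_self_add_left] at this
      linarith
    have h3 : ‖Φ (u + s • w) - Φ u - fderiv ℝ Φ u₀ (u + s • w - u)‖ ≤
        κ / 2 * ‖u + s • w - u‖ :=
      hball (y := (u + s • w, u)) (by
        rw [Prod.dist_eq]
        exact max_lt hsum (by linarith))
    rw [add_sub_cancel_left, map_smul, smul_eq_mul] at h3
    have h4 : ‖(fderiv ℝ Φ u - fderiv ℝ Φ u₀) w‖ ≤ κ / 2 :=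
      ((fderiv ℝ Φ u - fderiv ℝ Φ u₀).le_of_opNorm_le_of_le hD.le hw).trans_eq (mul_one _)
    rw [sub_apply] at h4
    have h5 := (le_abs_self _).trans h3
    have h6 := mul_le_mul_of_nonneg_left ((neg_le_abs _).trans h4) hs0.le
    have h7 := mul_le_mul_of_nonneg_left hsw (half_pos hκ).le
    linarith
  filter_upwards [nhdsWithin_le_nhds hloc, self_mem_nhdsWithin] with s hs hs0 u hu w hw
  exact hs u hu hs0 w hw

end Descent

/-! ### Symmetry and the equivariant deformation -/

section Invariance

variable {G : Type*} [Group G] {X : Type*} [NormedAddCommGroup X] [DistribMulAction G X]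

theorem isometry_smul_of_norm (hiso : ∀ (g : G) (x : X), ‖g • x‖ = ‖x‖) (g : G) :
    Isometry fun x : X => g • x :=
  Isometry.of_dist_eq fun x y => by rw [dist_eq_norm, dist_eq_norm, ← smul_sub, hiso]

theorem infEDist_smul (hiso : ∀ (g : G) (x : X), ‖g • x‖ = ‖x‖) {K : Set X}
    (hK : InvariantSet G K) (g : G) (x : X) : Metric.infEDist (g • x) K = Metric.infEDist x K := by
  conv_lhs => rw [← hK g]
  exact Metric.infEDist_image (isometry_smul_of_norm hiso g)

theorem InvariantSet.thickening (hiso : ∀ (g : G) (x : X), ‖g • x‖ = ‖x‖) {K : Set X}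
    (hK : InvariantSet G K) (r : ℝ) : InvariantSet G (Metric.thickening r K) :=
  invariantSet_of_smul_mem fun g x hx => by
    change Metric.infEDist (g • x) K < _
    rw [infEDist_smul hiso hK]
    exact hx

theorem InvariantSet.cthickening (hiso : ∀ (g : G) (x : X), ‖g • x‖ = ‖x‖) {K : Set X}
    (hK : InvariantSet G K) (r : ℝ) : InvariantSet G (Metric.cthickening r K) :=
  invariantSet_of_smul_mem fun g x hx => by
    change Metric.infEDist (g • x) K ≤ _
    rw [infEDist_smul hiso hK]
    exact hx

theorem InvariantSet.inter {A B : Set X} (hA : InvariantSet G A) (hB : InvariantSet G B) :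
    InvariantSet G (A ∩ B) :=
  invariantSet_of_smul_mem fun g _ hx => ⟨hA.smul_mem g hx.1, hB.smul_mem g hx.2⟩

theorem InvariantSet.diff {A B : Set X} (hA : InvariantSet G A) (hB : InvariantSet G B) :
    InvariantSet G (A \ B) :=
  invariantSet_of_smul_mem fun g x hx => ⟨hA.smul_mem g hx.1, fun h => hx.2 (by
    simpa using hB.smul_mem g⁻¹ h)⟩

variable [NormedSpace ℝ X] [SMulCommClass G ℝ X] {Φ : X → ℝ} {Ψ : X → EReal}

theorem fderiv_smul_smul (hiso : ∀ (g : G) (x : X), ‖g • x‖ = ‖x‖) (hd : Differentiable ℝ Φ)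
    (hΦ : ∀ (g : G) (u : X), Φ (g • u) = Φ u) (g : G) (u w : X) :
    fderiv ℝ Φ (g • u) (g • w) = fderiv ℝ Φ u w := by
  let L : X →L[ℝ] X :=
    { toFun := fun x => g • x
      map_add' := smul_add g
      map_smul' := fun r x => smul_comm g r x
      cont := (isometry_smul_of_norm hiso g).continuous }
  have h1 : HasFDerivAt (Φ ∘ L) ((fderiv ℝ Φ (g • u)).comp L) u :=
    HasFDerivAt.comp u (hd (g • u)).hasFDerivAt L.hasFDerivAt
  have h2 : Φ ∘ L = Φ := funext fun x => hΦ g x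
  rw [h2] at h1
  rw [h1.fderiv]
  rfl

theorem IsCriticalPoint.smul (hiso : ∀ (g : G) (x : X), ‖g • x‖ = ‖x‖) (hd : Differentiable ℝ Φ)
    (hΦ : ∀ (g : G) (u : X), Φ (g • u) = Φ u) (hΨ : ∀ (g : G) (u : X), Ψ (g • u) = Ψ u) {u : X}
    (hu : IsCriticalPoint Φ Ψ u) (g : G) : IsCriticalPoint Φ Ψ (g • u) := by
  refine ⟨by simpa only [energy, hΦ, hΨ] using hu.1, fun v => ?_⟩
  have h := hu.2 (g⁻¹ • v)
  rw [← fderiv_smul_smul hiso hd hΦ g, smul_sub, smul_inv_smul, hΨ] at h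
  rwa [hΨ]

theorem invariantSet_criticalSet (hiso : ∀ (g : G) (x : X), ‖g • x‖ = ‖x‖)
    (hd : Differentiable ℝ Φ) (hΦ : ∀ (g : G) (u : X), Φ (g • u) = Φ u)
    (hΨ : ∀ (g : G) (u : X), Ψ (g • u) = Ψ u) (c : ℝ) :
    InvariantSet G (criticalSet Φ Ψ c) :=
  invariantSet_of_smul_mem fun g u hu =>
    ⟨hu.1.smul hiso hd hΦ hΨ g, by simpa only [energy, hΦ, hΨ] using hu.2⟩

theorem smul_mem_descentSet (hiso : ∀ (g : G) (x : X), ‖g • x‖ = ‖x‖) (hd : Differentiable ℝ Φ)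
    (hΦ : ∀ (g : G) (u : X), Φ (g • u) = Φ u) (hΨ : ∀ (g : G) (u : X), Ψ (g • u) = Ψ u)
    {q s : ℝ} {u w : X} (hw : w ∈ descentSet Φ Ψ q s u) (g : G) :
    g • w ∈ descentSet Φ Ψ q s (g • u) := by
  refine ⟨by rw [hiso]; exact hw.1, ?_⟩
  rw [hΦ, fderiv_smul_smul hiso hd hΦ, ← smul_comm g s w, ← smul_add, hΨ]
  exact hw.2

variable [TopologicalSpace G] [IsTopologicalGroup G] [CompactSpace G] [ContinuousSMul G X]
  [CompleteSpace X]

/-- An equivariant deformation that lowers the functional along a compact invariant set. -/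
theorem ClassH0.eventually_exists_deformation (hI : ClassH0 Φ Ψ)
    (hiso : ∀ (g : G) (x : X), ‖g • x‖ = ‖x‖)
    (hΦ : ∀ (g : G) (u : X), Φ (g • u) = Φ u) (hΨ : ∀ (g : G) (u : X), Ψ (g • u) = Ψ u)
    {A : Set X} (hAc : IsCompact A) (hAi : InvariantSet G A)
    {c p ε : ℝ} (hε : 0 < ε) (hp : c - ε / 4 < p) (hpc : p ≤ c + ε)
    (hA : ∀ u ∈ A, energy Φ Ψ u ≤ p)
    (hslope : ∀ u ∈ A, ∀ a : ℝ, Ψ u = a → |Φ u + a - c| ≤ ε →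
      ∃ (v : X) (b : ℝ), Ψ v = b ∧ fderiv ℝ Φ u (v - u) + (b - a) < -(ε * ‖v - u‖)) :
    ∀ᶠ s in 𝓝[>] (0 : ℝ), ∃ η : X → X, Continuous η ∧ (∀ (g : G) (u : X), η (g • u) = g • η u) ∧
      ∀ u ∈ A, dist u (η u) ≤ s ∧ energy Φ Ψ (η u) ≤ ((p - s * (ε / 8) : ℝ) : EReal) := by
  have hd : Differentiable ℝ Φ := hI.contDiff.differentiable one_ne_zero
  filter_upwards [hI.eventually_exists_selection hAc hε hp hpc hA hslope,
    eventually_le_linearization hI.contDiff hAc (by positivity : 0 < ε / 8),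
    self_mem_nhdsWithin] with s hs hlin hs0
  obtain ⟨w, hwc, hw⟩ := hs
  obtain ⟨W, hWc, hWe, hWC⟩ := exists_equivariant_average (G := G) hwc
  -- Descent sets are closed, convex and carried along by `G`, so the average is again a selection.
  have hW : ∀ u ∈ A, W u ∈ descentSet Φ Ψ (p - s * (ε / 4)) s u := fun u hu =>
    hWC u _ (hI.convex_descentSet _ _ _) (hI.isClosed_descentSet _ _ _) fun g => by
      simpa using smul_mem_descentSet hiso hd hΦ hΨ (hw _ (hAi.smul_mem g⁻¹ hu)) g
  refine ⟨fun u => u + s • W u, by fun_prop, fun g u => ?_, fun u hu => ⟨?_, ?_⟩⟩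
  · simp only [hWe, smul_add, smul_comm g s]
  · rw [dist_self_add_right, norm_smul, Real.norm_of_nonneg (le_of_lt hs0)]
    exact mul_le_of_le_one_right (le_of_lt hs0) (hW u hu).1
  -- Of the decrease `s * (ε / 4)`, the linearization error consumes at most half.
  · obtain ⟨b, hb, hle⟩ := hI.exists_coe_of_mem_descentSet (hW u hu)
    rw [energy_of_eq_coe hb]
    have := hlin u hu (W u) (hW u hu).1
    exact_mod_cast (by linarith : Φ (u + s • W u) + b ≤ p - s * (ε / 8))

end Invariance

/-! ### The gap between minimax values -/

section Minimax

variable {G : Type*} [Group G] [TopologicalSpace G] [IsTopologicalGroup G] [CompactSpace G]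
  {X : Type*} [NormedAddCommGroup X] [NormedSpace ℝ X] [CompleteSpace X]
  [DistribMulAction G X] [SMulCommClass G ℝ X] [ContinuousSMul G X]
  {Y : Type*} [NormedAddCommGroup Y] [NormedSpace ℝ Y] [FiniteDimensional ℝ Y]
  [DistribMulAction G Y] [SMulCommClass G ℝ Y] [ContinuousSMul G Y]
  {Φ : X → ℝ} {Ψ : X → EReal}

/-- Near a negative level `c` whose critical set has index at most `n`, the minimax value rises by
a fixed amount when the index increases by `n`. -/
theorem exists_minimaxValue_gap (hI : ClassH0 Φ Ψ) (hPS : PalaisSmale Φ Ψ)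
    (hiso : ∀ (g : G) (x : X), ‖g • x‖ = ‖x‖)
    (hΦ : ∀ (g : G) (u : X), Φ (g • u) = Φ u) (hΨ : ∀ (g : G) (u : X), Ψ (g • u) = Ψ u)
    (hI0 : energy Φ Ψ 0 = 0) {c : ℝ} (hc : c < 0) {n : ℕ}
    (hn : HasIndexMap G Y (criticalSet Φ Ψ c) n) :
    ∃ δ > 0, ∀ j : ℕ, 1 ≤ j → ((c - δ : ℝ) : EReal) < minimaxValue G Y Φ Ψ j →
      ((c + δ : ℝ) : EReal) ≤ minimaxValue G Y Φ Ψ (j + n) := by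
  set K := criticalSet Φ Ψ c with hK
  have hKc : IsCompact K := isCompact_criticalSet hI hPS c
  have hKi : InvariantSet G K :=
    invariantSet_criticalSet hiso (hI.contDiff.differentiable one_ne_zero) hΦ hΨ c
  obtain ⟨U, hU, hKU, hUn⟩ := hn.exists_isOpen hKi hKc.isClosed
  obtain ⟨ρ, hρ, hρU⟩ := hKc.exists_cthickening_subset_open hU hKU
  obtain ⟨ε, hε, hslope⟩ := exists_uniform_slope hI hPS c (half_pos hρ)
  -- The three bounds keep the levels within the slope estimate, keep `c + δ ≤ 0` so that `0` is
  -- excluded, and limit the Ekeland displacement to `ρ / 4`.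
  let δ : ℝ := min (ε / 4) (min (-c) (ε / 16 * (ρ / 4) / 2))
  have hδ : 0 < δ := lt_min (by positivity) (lt_min (by linarith) (by positivity))
  have hδ1 : δ ≤ ε / 4 := min_le_left _ _
  have hδ2 : δ ≤ -c := (min_le_right _ _).trans (min_le_left _ _)
  have hδ3 : δ ≤ ε / 16 * (ρ / 4) / 2 := (min_le_right _ _).trans (min_le_right _ _)
  refine ⟨δ, hδ, fun j hj hlow => ?_⟩
  by_contra hlt
  rw [not_le, minimaxValue] at hlt
  simp only [iInf_lt_iff] at hlt
  obtain ⟨A₀, hA₀, hA₀c⟩ := hlt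
  have hle : ∀ B ∈ GammaFamily (X := X) G Y j,
      minimaxValue G Y Φ Ψ j ≤ ⨆ u ∈ (B : Set X), energy Φ Ψ u := fun B hB => iInf₂_le B hB
  have h0 : ∀ {B : Set X} {q : ℝ}, q < 0 → (∀ u ∈ B, energy Φ Ψ u ≤ q) → (0 : X) ∉ B := by
    intro B q hq hB h
    have := hB 0 h
    rw [hI0] at this
    exact absurd (by exact_mod_cast this : (0 : ℝ) ≤ q) (not_le.2 hq)
  have hA₀i := InvariantSet.of_mem_gammaFamily hiso hA₀
  have hA₀j := natCast_le_gIndex_iff.1 (le_gIndex_of_mem_gammaFamily hiso hA₀)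
  have hA₀le : ∀ u ∈ (A₀ : Set X), energy Φ Ψ u < ((c + δ : ℝ) : EReal) := fun u hu =>
    (le_iSup₂ (f := fun u (_ : u ∈ (A₀ : Set X)) => energy Φ Ψ u) u hu).trans_lt hA₀c
  have hA₁i : InvariantSet G ((A₀ : Set X) \ Metric.thickening ρ K) :=
    hA₀i.diff (hKi.thickening hiso ρ)
  have hA₁c : IsCompact ((A₀ : Set X) \ Metric.thickening ρ K) :=
    A₀.isCompact.diff Metric.isOpen_thickening
  have hA₁j : ∀ k < j, ¬ HasIndexMap G Y ((A₀ : Set X) \ Metric.thickening ρ K) k := by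
    intro k hk h
    -- The removed part lies in the closed `ρ`-neighbourhood of `K`, of index at most `n`;
    -- subadditivity needs closed pieces.
    refine hA₀j (k + n) (by omega) ((h.union hA₁i hA₁c.isClosed
      (hA₀i.inter (hKi.cthickening hiso ρ))
      (A₀.isCompact.isClosed.inter Metric.isClosed_cthickening)
      (hUn.mono (Set.inter_subset_right.trans hρU))).mono fun x hx => ?_)
    by_cases hxK : x ∈ Metric.thickening ρ K
    · exact Or.inr ⟨hx, Metric.thickening_subset_cthickening _ _ hxK⟩
    · exact Or.inl ⟨hx, hxK⟩
  have hA₁n : ((A₀ : Set X) \ Metric.thickening ρ K).Nonempty := by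
    rw [Set.nonempty_iff_ne_empty]
    intro h
    exact hA₁j 0 (by omega) (h ▸ hasIndexMap_empty 0)
  let A₁ : NonemptyCompacts X := ⟨⟨_, hA₁c⟩, hA₁n⟩
  have hA₁Γ : A₁ ∈ GammaFamily (X := X) G Y j :=
    mem_gammaFamily hA₁i (fun h => by
      have := hA₀le 0 h.1
      rw [hI0] at this
      have : (0 : ℝ) < c + δ := by exact_mod_cast this
      linarith) (natCast_le_gIndex_iff.2 hA₁j)
  have hA₁le : (⨆ u ∈ (A₁ : Set X), energy Φ Ψ u) ≤ ⨆ u ∈ (A₀ : Set X), energy Φ Ψ u :=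
    biSup_mono fun u hu => hu.1
  -- The Ekeland slope `ε / 16` is chosen below the deformation rate `ε / 8`.
  obtain ⟨A, hA, hdist, p, hp, hpA₁, hmin⟩ := exists_ekeland_of_isClosed
    (lowerSemicontinuous_iSup_nonemptyCompacts hI.lowerSemicontinuous_energy)
    (S := GammaFamily (X := X) G Y j) isClosed_closure hA₁Γ (m := c - δ) (ε := ε / 16)
    (r := ρ / 4) (by positivity) (fun B hB => hlow.le.trans (hle B hB))
    ((hA₁le.trans hA₀c.le).trans (by exact_mod_cast (by linarith :
      c + δ ≤ c - δ + ε / 16 * (ρ / 4))))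
  have hp1 : c - δ < p := by
    have := hlow.trans_le (hle A hA)
    rw [hp] at this
    exact_mod_cast this
  have hp2 : p < c + δ := by
    have := (hpA₁.trans hA₁le).trans_lt hA₀c
    rw [hp] at this
    exact_mod_cast this
  have hAp : ∀ u ∈ (A : Set X), energy Φ Ψ u ≤ p := fun u hu =>
    hp ▸ le_iSup₂ (f := fun u (_ : u ∈ (A : Set X)) => energy Φ Ψ u) u hu
  have hAi := InvariantSet.of_mem_gammaFamily hiso hA
  have hAK : ∀ u ∈ (A : Set X), u ∉ Metric.thickening (ρ / 2) K := by
    intro u hu hthick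
    obtain ⟨z, hz, huz⟩ := Metric.mem_thickening_iff.1 hthick
    obtain ⟨v, hv, huv⟩ := exists_dist_lt_of_nonemptyCompacts
      ((dist_comm A A₁).trans_le hdist |>.trans_lt (by linarith : ρ / 4 < ρ / 2)) hu
    refine hv.2 (Metric.mem_thickening_iff.2 ⟨z, hz, ?_⟩)
    have := dist_triangle_left v z u
    linarith
  obtain ⟨s, ⟨η, hηc, hηe, hη⟩, hs⟩ := ((hI.eventually_exists_deformation hiso hΦ hΨ A.isCompact
    hAi hε (by linarith) (by linarith) hAp fun u hu a ha h =>
      hslope u a ha h (hAK u hu)).and self_mem_nhdsWithin).exists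
  have hs : 0 < s := hs
  let B : NonemptyCompacts X := ⟨⟨η '' A, A.isCompact.image hηc⟩, A.nonempty.image η⟩
  have hBp : ∀ u ∈ (B : Set X), energy Φ Ψ u ≤ ((p - s * (ε / 8) : ℝ) : EReal) := by
    rintro _ ⟨u, hu, rfl⟩
    exact (hη u hu).2
  have hBΓ : B ∈ GammaFamily (X := X) G Y j := by
    refine mem_gammaFamily (invariantSet_of_smul_mem ?_) (h0 ?_ hBp)
      (natCast_le_gIndex_iff.2 fun k hk h => ?_)
    · rintro g _ ⟨u, hu, rfl⟩
      exact ⟨g • u, hAi.smul_mem g hu, hηe g u⟩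
    · have : 0 < s * (ε / 8) := by positivity
      linarith
    · exact natCast_le_gIndex_iff.1 (le_gIndex_of_mem_gammaFamily hiso hA) k hk
        (h.comp ⟨hηc.continuousOn, fun g u _ => hηe g u⟩ (Set.mapsTo_image η A))
  have hAB : dist A B ≤ s := by
    rw [Metric.NonemptyCompacts.dist_eq]
    refine Metric.hausdorffDist_le_of_mem_dist hs.le
      (fun u hu => ⟨η u, ⟨u, hu, rfl⟩, (hη u hu).1⟩) ?_
    rintro _ ⟨u, hu, rfl⟩
    exact ⟨u, hu, by rw [dist_comm]; exact (hη u hu).1⟩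
  -- Ekeland gives `p ≤ p - s * (ε / 8) + (ε / 16) * s`, which is impossible for `s > 0`.
  have h1 := hmin B hBΓ _ (iSup₂_le hBp)
  have h2 := mul_le_mul_of_nonneg_left hAB (by positivity : 0 ≤ ε / 16)
  have h3 : 0 < s * ε := by positivity
  linarith

end Minimax

end SzulkinHeinz

/-! ### The minimax theorem -/

theorem theorem3p2
    {G : Type*} [Group G] [TopologicalSpace G] [IsTopologicalGroup G] [CompactSpace G]
    {X : Type*} [NormedAddCommGroup X] [NormedSpace ℝ X] [CompleteSpace X]
    [DistribMulAction G X] [SMulCommClass G ℝ X] [ContinuousSMul G X]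
    {Y : Type*} [NormedAddCommGroup Y] [NormedSpace ℝ Y] [FiniteDimensional ℝ Y]
    [DistribMulAction G Y] [SMulCommClass G ℝ Y] [ContinuousSMul G Y]
    (Φ : X → ℝ) (Ψ : X → EReal)
    (hI : ClassH0 Φ Ψ)
    (hPS : PalaisSmale Φ Ψ)
    (hΦ : ∀ (g : G) (u : X), Φ (g • u) = Φ u)
    (hΨ : ∀ (g : G) (u : X), Ψ (g • u) = Ψ u)
    (hI0 : energy Φ Ψ 0 = 0)
    (hG0 : ConditionG0 G X Y)
    (hGstar : ∀ A : Set X, SigmaClass G A → IsCompact A → gIndex G Y A < ⊤)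
    (hc : ∀ j : ℕ, ⊥ < minimaxValue G Y Φ Ψ j)
    (hneg : ∀ j : ℕ, ∃ A : Set X, SigmaClass G A ∧ A.Nonempty ∧ IsCompact A ∧
      (j : ℕ∞) ≤ gIndex G Y A ∧ ⨆ u ∈ A, energy Φ Ψ u < 0) :
    (∀ j : ℕ, minimaxValue G Y Φ Ψ j < 0 ∧
      ∃ u : X, IsCriticalPoint Φ Ψ u ∧ energy Φ Ψ u = minimaxValue G Y Φ Ψ j) ∧
    Tendsto (fun j : ℕ => minimaxValue G Y Φ Ψ j) atTop (𝓝 0) := by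
  have hiso := hG0.1
  have hlt : ∀ j, minimaxValue G Y Φ Ψ j < 0 := fun j => minimaxValue_lt_of_exists (hneg j)
  have hcrit : ∀ j, 1 ≤ j →
      ∃ u : X, IsCriticalPoint Φ Ψ u ∧ energy Φ Ψ u = minimaxValue G Y Φ Ψ j := by
    intro j hj
    obtain ⟨c, hcj⟩ : ∃ c : ℝ, (c : EReal) = minimaxValue G Y Φ Ψ j :=
      ⟨_, EReal.coe_toReal (hlt j).ne_top (hc j).ne'⟩
    have hc0 : c < 0 := by exact_mod_cast hcj ▸ hlt j
    rw [← hcj]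
    by_contra! hK
    have hK' : criticalSet Φ Ψ c = ∅ := Set.eq_empty_of_forall_notMem fun u hu => hK u hu.1 hu.2
    obtain ⟨δ, hδ, hgap⟩ := exists_minimaxValue_gap (Y := Y) (n := 0) hI hPS hiso hΦ hΨ hI0 hc0
      (hK' ▸ hasIndexMap_empty 0)
    have h := hgap j hj (hcj ▸ by exact_mod_cast sub_lt_self c hδ)
    rw [add_zero, ← hcj] at h
    have : c + δ ≤ c := by exact_mod_cast h
    linarith
  refine ⟨fun j => ⟨hlt j, ?_⟩, ?_⟩
  -- Nonempty sets have index at least `1`, so `Γ_0 = Γ_1` and the index `0` adds nothing new.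
  · rcases Nat.eq_zero_or_pos j with rfl | hj
    · have h01 : minimaxValue G Y Φ Ψ 0 = minimaxValue G Y Φ Ψ 1 := by
        rw [minimaxValue, minimaxValue, gammaFamily_zero]
      rw [h01]
      exact hcrit 1 le_rfl
    · exact hcrit j hj
  · have hmono : Monotone (minimaxValue G Y Φ Ψ) := minimaxValue_monotone
    have hlim := tendsto_atTop_iSup hmono
    suffices h : ⨆ j, minimaxValue G Y Φ Ψ j = 0 by rwa [h] at hlim
    refine le_antisymm (iSup_le fun j => (hlt j).le) (not_lt.1 fun hsup => ?_)
    obtain ⟨c, hcs⟩ : ∃ c : ℝ, (c : EReal) = ⨆ j, minimaxValue G Y Φ Ψ j :=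
      ⟨_, EReal.coe_toReal hsup.ne_top ((hc 0).trans_le (le_iSup _ 0)).ne'⟩
    have hc0 : c < 0 := by exact_mod_cast hcs ▸ hsup
    have hKc : IsCompact (criticalSet Φ Ψ c) := isCompact_criticalSet hI hPS c
    have hKS : SigmaClass G (criticalSet Φ Ψ c) := by
      refine ⟨invariantSet_criticalSet hiso (hI.contDiff.differentiable one_ne_zero) hΦ hΨ c,
        hKc.isClosed, fun h => ?_⟩
      have h' := h.2
      rw [hI0] at h'
      exact hc0.ne' (by exact_mod_cast h')
    obtain ⟨n, hn⟩ := ENat.ne_top_iff_exists.1 (hGstar _ hKS hKc).ne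
    obtain ⟨δ, hδ, hgap⟩ := exists_minimaxValue_gap (Y := Y) hI hPS hiso hΦ hΨ hI0 hc0
      (gIndex_le_iff.1 hn.ge)
    have hlow : ((c - δ : ℝ) : EReal) < ⨆ j, minimaxValue G Y Φ Ψ j :=
      hcs ▸ by exact_mod_cast sub_lt_self c hδ
    obtain ⟨j, hj⟩ := lt_iSup_iff.1 hlow
    have h1 := hgap (max j 1) (le_max_right _ _) (hj.trans_le (hmono (le_max_left _ _)))
    have h2 := h1.trans (le_iSup (minimaxValue G Y Φ Ψ) _)
    rw [← hcs] at h2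
    have : c + δ ≤ c := by exact_mod_cast h2
    linarith
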